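/- Let $\mathbb H=\{z\in\mathbb C:\operatorname{Im} z\ge 0\}$. The Pólya–Obrechkoff class $\mathcal{PO}$ is the set of entire functions that can be written as $$f(z)=c\,z^m e^{-\alpha z^2+\beta z}\prod_j\Bigl(1-\frac z{a_j}\Bigr)e^{z/a_j}\qquad(z\in\mathbb C),$$ where $c,\beta\in\mathbb C$, $m$ is a nonnegative integer, $\alpha\ge 0$, and $(a_j)$ is an empty, finite or infinite sequence in $\mathbb H\setminus\{0\}$ with $\sum_j|a_j|^{-2}<\infty$ and $\sum_j\operatorname{Im}(-a_j^{-1})\le\operatorname{Im}\beta$. Theorem 1.1. Let $\langle f_n\rangle$ be a sequence of complex polynomials such that, for every $n$, either $f_n$ is identically $0$ or all zeros of $f_n$ lie in $\mathbb H$. Suppose that $f_n$ converges weakly to a formal power series $f=\sum_{k\ge0}c_kz^k\in\mathbb C[[z]]$, that is, $\lim_{n\to\infty}f_n^{(k)}(0)=k!\,c_k$ for every $k\ge0$, and that $c_k\ne0$ for some $k$. Then $f$ converges on all of $\mathbb C$ and represents an entire function in $\mathcal{PO}$, and $f_n\to f$ uniformly on compact subsets of $\mathbb C$. -/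

import Mathlib

open Filter Topology

/-- The closed upper half plane `{z : 0 ≤ Im z}`. -/
def closedUpperHalfPlane : Set ℂ := {z : ℂ | 0 ≤ z.im}

/-- The set of zeros of `f : ℂ → ℂ`; by convention it is empty if `f` is identically `0`. -/
def zeroSet (f : ℂ → ℂ) : Set ℂ := {z : ℂ | (∃ w : ℂ, f w ≠ 0) ∧ f z = 0}

/-- The Pólya–Obrechkoff class: the entire functions of the form
`f z = c * z ^ m * exp (-α z² + β z) * ∏ⱼ (1 - z / aⱼ) exp (z / aⱼ)`, where `α ≥ 0`, the `aⱼ` form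
an empty, finite or infinite family of nonzero points of the closed upper half plane with
`∑ |aⱼ|⁻² < ∞`, and `∑ Im (-1 / aⱼ)` converges and is at most `Im β`. -/
def IsPolyaObrechkoff (f : ℂ → ℂ) : Prop :=
  Differentiable ℂ f ∧
  ∃ (c : ℂ) (m : ℕ) (α : ℝ) (β : ℂ) (ι : Type) (_ : Countable ι) (a : ι → ℂ),
    0 ≤ α ∧
    (∀ j, a j ∈ closedUpperHalfPlane \ {0}) ∧
    Summable (fun j => (‖a j‖ ^ 2)⁻¹) ∧
    Summable (fun j => (-(a j)⁻¹).im) ∧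
    ∑' j, (-(a j)⁻¹).im ≤ β.im ∧
    ∀ z : ℂ,
      Multipliable (fun j => (1 - z / a j) * Complex.exp (z / a j)) ∧
      f z = c * z ^ m * Complex.exp (-(α : ℂ) * z ^ 2 + β * z) *
        ∏' j, ((1 - z / a j) * Complex.exp (z / a j))

/-- Weak convergence of a sequence of entire functions to a formal power series: for every `k`, the
`k`-th derivatives at `0` converge, and their limit divided by `k!` is the `k`-th coefficient. -/
def ConvergesWeakly (F : ℕ → ℂ → ℂ) (f : PowerSeries ℂ) : Prop :=
  ∀ k : ℕ, Tendsto (fun n => iteratedDeriv k (F n) 0) atTop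
    (𝓝 ((k.factorial : ℂ) * PowerSeries.coeff k f))

/-- Strong convergence: uniform convergence on compact subsets of the complex plane. -/
def ConvergesStrongly (F : ℕ → ℂ → ℂ) (g : ℂ → ℂ) : Prop :=
  ∀ K : Set ℂ, IsCompact K → TendstoUniformlyOn F g atTop K

/-- The formal power series `f` represents the entire function `g`: it converges to `g` on all
of `ℂ` (so its radius of convergence is infinite). -/
def RepresentsEntire (f : PowerSeries ℂ) (g : ℂ → ℂ) : Prop :=
  Differentiable ℂ g ∧ ∀ z : ℂ, HasSum (fun k : ℕ => PowerSeries.coeff k f * z ^ k) (g z)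

/-!

The sequence is controlled through the reciprocals `b` of the zeros of the polynomials. For a
polynomial `p` with `p 0 ≠ 0` and zeros in the closed upper half plane all `Im b` are `≤ 0`, so
`∑ |Im b|` is the imaginary part of the linear coefficient of `p / p 0`; since
`|b|² = Re (b²) + 2 (Im b)²` and `∑ b²` is given by the first coefficients as well, these
coefficients bound `∑ |b|²` (`exists_reciprocal_roots`), and with it the growth of `p`
(`norm_eval_le_of_roots_im_nonneg`).

*Convergence.* Let `c k` be the limits of the coefficients of the `P n`. If `c m ≠ 0`, the growth
bound applies to the `m`-th derivatives, whose zeros stay in the half plane by the Gauss-Lucas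
theorem. Cauchy's estimates then bound the coefficients geometrically with any ratio
(`exists_eventually_norm_coeff_le`), and dominated convergence gives locally uniform convergence
(`tendstoUniformlyOn_eval_tsum`).

*The form of the limit.* Suppose `c 0 ≠ 0`. The reciprocal zeros `b_{n,j}`, sorted by decreasing
modulus, satisfy `|b_{n,j}|² ≤ B / (j + 1)` and converge, for each `j`, along an ultrafilter to
some `b_j`. The genus two products `∏ⱼ (1 - z b_{n,j}) exp (z b_{n,j} + (z b_{n,j})² / 2)`
converge by dominated convergence (`tendsto_tprod_genus_two`). The quadratic correction leaves the
exponent `α = (lim ∑ⱼ b_{n,j}² - ∑ⱼ b_j²) / 2`. Because `b² = |b|² + 2 i b Im b` and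
`∑ⱼ b_{n,j} Im b_{n,j}` passes to the limit, its tails being uniformly small, `2 α` is the loss of
mass in `∑ⱼ |b_{n,j}|²`, which is nonnegative (`exists_tendsto_eval_of_coeff_zero_ne_zero`). In
the same way `∑ Im (-b_j) ≤ Im β`.

A zero of the limit at the origin is removed by dividing `P n` by `X - a n`, where `a n → 0` is a
zero of `P n` (`eventually_exists_mem_roots_norm_lt`, `exists_tendsto_root_divByMonic`).
-/

/-! ### Elementary factors -/

theorem norm_one_sub_mul_exp_le (w : ℂ) :
    ‖(1 - w) * Complex.exp w‖ ≤ Real.exp (‖w‖ ^ 2 / 2) := by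
  have h1 : ‖1 - w‖ ^ 2 = 1 - 2 * w.re + ‖w‖ ^ 2 := by
    rw [Complex.sq_norm, Complex.sq_norm, Complex.normSq_apply, Complex.normSq_apply]
    simp
    ring
  have h2 : ‖1 - w‖ ^ 2 ≤ Real.exp (‖w‖ ^ 2 / 2 - w.re) ^ 2 := by
    rw [h1, ← Real.exp_nat_mul]
    have := Real.add_one_le_exp (((2 : ℕ) : ℝ) * (‖w‖ ^ 2 / 2 - w.re))
    push_cast at this ⊢
    linarith
  have h3 := (sq_le_sq₀ (norm_nonneg _) (Real.exp_pos _).le).1 h2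
  rw [norm_mul, Complex.norm_exp]
  calc _ ≤ Real.exp (‖w‖ ^ 2 / 2 - w.re) * Real.exp w.re := by gcongr
    _ = _ := by rw [← Real.exp_add]; congr 1; ring

theorem norm_one_sub_mul_exp_sub_one_le (w : ℂ) :
    ‖(1 - w) * Complex.exp w - 1‖ ≤ ‖w‖ ^ 2 * Real.exp ‖w‖ := by
  have hd : ∀ x : ℂ, HasDerivAt (fun w : ℂ => (1 - w) * Complex.exp w) (-x * Complex.exp x) x := by
    intro x
    refine (((hasDerivAt_id' x).const_sub 1).fun_mul (Complex.hasDerivAt_exp x)).congr_deriv ?_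
    ring
  have := (convex_closedBall (0 : ℂ) ‖w‖).norm_image_sub_le_of_norm_hasDerivWithin_le
    (fun x _ => (hd x).hasDerivWithinAt) (C := ‖w‖ * Real.exp ‖w‖) ?_
    (show (0 : ℂ) ∈ _ by simp) (show w ∈ _ by simp)
  · simp only [sub_zero, Complex.exp_zero, one_mul] at this
    calc _ ≤ _ := this
      _ = _ := by ring
  · intro x hx
    have hx : ‖x‖ ≤ ‖w‖ := by simpa using hx
    rw [norm_mul, norm_neg, Complex.norm_exp]
    gcongr
    exact (Complex.re_le_norm x).trans hx

theorem norm_one_sub_mul_exp_add_sq_sub_one_le (w : ℂ) :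
    ‖(1 - w) * Complex.exp (w + w ^ 2 / 2) - 1‖ ≤ ‖w‖ ^ 3 * Real.exp (‖w‖ + ‖w‖ ^ 2 / 2) := by
  have hd : ∀ x : ℂ, HasDerivAt (fun w : ℂ => (1 - w) * Complex.exp (w + w ^ 2 / 2))
      (-x ^ 2 * Complex.exp (x + x ^ 2 / 2)) x := by
    intro x
    refine (((hasDerivAt_id' x).const_sub 1).fun_mul
      ((hasDerivAt_id' x).fun_add ((hasDerivAt_pow 2 x).div_const 2)).cexp).congr_deriv ?_
    simp
    ring
  have := (convex_closedBall (0 : ℂ) ‖w‖).norm_image_sub_le_of_norm_hasDerivWithin_le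
    (fun x _ => (hd x).hasDerivWithinAt) (C := ‖w‖ ^ 2 * Real.exp (‖w‖ + ‖w‖ ^ 2 / 2)) ?_
    (show (0 : ℂ) ∈ _ by simp) (show w ∈ _ by simp)
  · simp only [sub_zero, ne_eq, OfNat.ofNat_ne_zero, not_false_eq_true, zero_pow, zero_div,
      add_zero, Complex.exp_zero, one_mul] at this
    calc _ ≤ _ := this
      _ = _ := by ring
  · intro x hx
    have hx : ‖x‖ ≤ ‖w‖ := by simpa using hx
    rw [norm_mul, norm_neg, norm_pow, Complex.norm_exp]
    gcongr
    refine (Complex.re_le_norm _).trans ((norm_add_le _ _).trans ?_)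
    rw [norm_div, norm_pow, Complex.norm_ofNat]
    gcongr

theorem multipliable_one_sub_mul_exp {b : ℕ → ℂ} (hb : Summable fun j => ‖b j‖ ^ 2) (z : ℂ) :
    Multipliable fun j => (1 - z * b j) * Complex.exp (z * b j) := by
  have h := multipliable_one_add_of_summable
    (f := fun j => (1 - z * b j) * Complex.exp (z * b j) - 1) ?_
  · simpa using h
  have h0 : Tendsto (fun j => ‖b j‖) atTop (𝓝 0) := by
    simpa [Real.sqrt_sq] using hb.tendsto_atTop_zero.sqrt
  have h1 : Tendsto (fun j => ‖z * b j‖) atTop (𝓝 0) := by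
    simpa using h0.const_mul ‖z‖
  refine Summable.of_norm_bounded_eventually_nat (g := fun j => ‖z‖ ^ 2 * Real.exp 1 * ‖b j‖ ^ 2)
    (hb.mul_left _) ?_
  filter_upwards [h1.eventually_le_const one_pos] with j hj
  rw [norm_norm]
  calc _ ≤ _ := norm_one_sub_mul_exp_sub_one_le _
    _ ≤ ‖z * b j‖ ^ 2 * Real.exp 1 := by gcongr
    _ = _ := by rw [norm_mul]; ring

/-! ### Reciprocal roots of a polynomial with zeros in the closed upper half plane -/

open Polynomial in
theorem coeff_prod_one_sub (b : ℕ → ℂ) (N : ℕ) :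
    (∏ j ∈ Finset.range N, (1 - C (b j) * X)).coeff 0 = 1 ∧
    (∏ j ∈ Finset.range N, (1 - C (b j) * X)).coeff 1 = -∑ j ∈ Finset.range N, b j ∧
    2 * (∏ j ∈ Finset.range N, (1 - C (b j) * X)).coeff 2 =
      (∑ j ∈ Finset.range N, b j) ^ 2 - ∑ j ∈ Finset.range N, b j ^ 2 := by
  induction N with
  | zero => simp [coeff_one]
  | succ N ih =>
    obtain ⟨h0, h1, h2⟩ := ih
    have key : ∀ k, (∏ j ∈ Finset.range (N + 1), (1 - C (b j) * X)).coeff (k + 1) =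
        (∏ j ∈ Finset.range N, (1 - C (b j) * X)).coeff (k + 1) -
          b N * (∏ j ∈ Finset.range N, (1 - C (b j) * X)).coeff k := by
      intro k
      rw [Finset.prod_range_succ, mul_sub, mul_one, coeff_sub, ← mul_assoc, coeff_mul_X, mul_comm,
        coeff_C_mul]
    refine ⟨?_, ?_, ?_⟩
    · rw [Finset.prod_range_succ, mul_coeff_zero, h0]
      simp
    · rw [key 0, h1, h0, Finset.sum_range_succ]
      ring
    · rw [key 1, mul_sub, h2, h1, Finset.sum_range_succ, Finset.sum_range_succ]
      ring

open Polynomial in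
theorem exists_sorted_reciprocal_roots {p : ℂ[X]} (h0 : p.coeff 0 ≠ 0)
    (hp : ∀ a ∈ p.roots, 0 ≤ a.im) :
    ∃ (b : ℕ → ℂ) (N : ℕ), (∀ j, (b j).im ≤ 0) ∧ Antitone (fun j => ‖b j‖) ∧
      (∀ j, N ≤ j → b j = 0) ∧
      p = C (p.coeff 0) * ∏ j ∈ Finset.range N, (1 - C (b j) * X) := by
  let r : ℂ → ℂ → Prop := fun x y => ‖y‖ ≤ ‖x‖
  have : DecidableRel r := fun _ _ => Classical.dec _
  have : Std.Total r := ⟨fun x y => le_total ‖y‖ ‖x‖⟩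
  have : IsTrans ℂ r := ⟨fun x y z h1 h2 => le_trans h2 h1⟩
  set L := (p.roots.map (·⁻¹)).toList.insertionSort r with hL
  have hsort : L.Pairwise r := List.pairwise_insertionSort r _
  have hperm : (L : Multiset ℂ) = p.roots.map (·⁻¹) := by
    rw [hL, Multiset.coe_eq_coe.2 (List.perm_insertionSort r _), Multiset.coe_toList]
  have hmem : ∀ x ∈ L, x.im ≤ 0 := by
    intro x hx
    have : x ∈ p.roots.map (·⁻¹) := by rw [← hperm]; exact hx
    obtain ⟨a, ha, rfl⟩ := Multiset.mem_map.1 this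
    rw [Complex.inv_im]
    exact div_nonpos_of_nonpos_of_nonneg (neg_nonpos.2 (hp a ha)) (Complex.normSq_nonneg _)
  have hfac : ∀ s : Multiset ℂ, 0 ∉ s → ∃ k : ℂ, (s.map fun a => X - C a).prod =
      C k * (s.map fun a => 1 - C a⁻¹ * X).prod := by
    intro s
    induction s using Multiset.induction_on with
    | empty => exact fun _ => ⟨1, by simp⟩
    | cons a s ih =>
      intro hs
      rw [Multiset.mem_cons, not_or] at hs
      obtain ⟨k, hk⟩ := ih hs.2
      refine ⟨-a * k, ?_⟩
      have : (X - C a : ℂ[X]) = C (-a) * (1 - C a⁻¹ * X) := by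
        rw [mul_sub, ← mul_assoc, ← C_mul, neg_mul, mul_inv_cancel₀ (Ne.symm hs.1)]
        simp
        ring
      rw [Multiset.map_cons, Multiset.prod_cons, Multiset.map_cons, Multiset.prod_cons, hk, this,
        C_mul]
      ring
  have h0r : 0 ∉ p.roots := fun h => h0 (by
    rw [coeff_zero_eq_eval_zero]; exact (mem_roots'.1 h).2)
  obtain ⟨k, hk⟩ := hfac _ h0r
  have hprod : ∏ j ∈ Finset.range L.length, (1 - C (L.getD j 0) * X) =
      (p.roots.map fun a => 1 - C a⁻¹ * X).prod := by
    have : (p.roots.map fun a => 1 - C a⁻¹ * X) =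
        (p.roots.map (·⁻¹)).map (fun b => 1 - C b * X) := by
      rw [Multiset.map_map]; rfl
    rw [this, ← hperm, Multiset.map_coe, Multiset.prod_coe, Finset.prod_range,
      ← List.prod_ofFn]
    congr 1
    apply List.ext_getElem <;> simp
  have hpk : p = C (p.leadingCoeff * k) *
      ∏ j ∈ Finset.range L.length, (1 - C (L.getD j 0) * X) := by
    rw [hprod, C_mul, mul_assoc, ← hk]
    exact (IsAlgClosed.splits p).eq_prod_roots
  refine ⟨fun j => L.getD j 0, L.length, ?_, ?_, ?_, ?_⟩
  · intro j
    by_cases hj : j < L.length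
    · simp only [List.getD_eq_getElem _ _ hj]
      exact hmem _ (List.getElem_mem hj)
    · simp only [List.getD_eq_default _ _ (not_lt.1 hj), Complex.zero_im, le_refl]
  · intro i j hij
    by_cases hj : j < L.length
    · simp only [List.getD_eq_getElem _ _ hj, List.getD_eq_getElem _ _ (hij.trans_lt hj)]
      rcases hij.lt_or_eq with h | rfl
      · exact List.pairwise_iff_getElem.1 hsort i j _ _ h
      · exact le_rfl
    · simp only [List.getD_eq_default _ _ (not_lt.1 hj), norm_zero, norm_nonneg]
  · intro j hj
    exact List.getD_eq_default _ _ hj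
  · have hc : p.coeff 0 = p.leadingCoeff * k := by
      conv_lhs => rw [hpk]
      rw [coeff_C_mul, (coeff_prod_one_sub _ _).1, mul_one]
    rw [hc]
    exact hpk

open Polynomial in
theorem roots_derivative_im_nonneg {p : ℂ[X]} (hp : ∀ a ∈ p.roots, 0 ≤ a.im) :
    ∀ a ∈ (derivative p).roots, 0 ≤ a.im := by
  intro a ha
  obtain ⟨hne, hroot⟩ := mem_roots'.1 ha
  have hdeg : 0 < p.degree := by
    by_contra h
    rw [eq_C_of_degree_le_zero (not_lt.1 h)] at hne
    simp at hne
  have hconv : Convex ℝ {z : ℂ | 0 ≤ z.im} := convex_halfSpace_im_ge 0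
  have hsub : p.rootSet ℂ ⊆ {z : ℂ | 0 ≤ z.im} := by
    intro z hz
    apply hp
    rw [mem_rootSet'] at hz
    rw [mem_roots']
    simpa using hz
  refine convexHull_min hsub hconv (rootSet_derivative_subset_convexHull_rootSet hdeg ?_)
  rw [mem_rootSet', coe_aeval_eq_eval, Algebra.algebraMap_self, Polynomial.map_id]
  exact ⟨hne, hroot⟩

open Polynomial in
/-- The estimate `T ≤ …` controls the absolute square sum of the reciprocal roots by the first three
coefficients; it rests on `|b|² = Re (b²) + 2 (Im b)²` and on all `Im b` having the same sign. -/
theorem exists_reciprocal_roots {p : ℂ[X]} (h0 : p.coeff 0 ≠ 0)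
    (hp : ∀ a ∈ p.roots, 0 ≤ a.im) :
    ∃ (b : ℕ → ℂ) (N : ℕ) (T : ℝ), (∀ j, (b j).im ≤ 0) ∧ Antitone (fun j => ‖b j‖) ∧
      (∀ j, N ≤ j → b j = 0) ∧
      HasSum b (-(p.coeff 1 / p.coeff 0)) ∧
      HasSum (fun j => b j ^ 2) ((p.coeff 1 / p.coeff 0) ^ 2 - 2 * (p.coeff 2 / p.coeff 0)) ∧
      HasSum (fun j => ‖b j‖ ^ 2) T ∧
      T ≤ 3 * ‖p.coeff 1 / p.coeff 0‖ ^ 2 + 2 * ‖p.coeff 2 / p.coeff 0‖ ∧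
      ∀ z, p.eval z = p.coeff 0 * ∏ j ∈ Finset.range N, (1 - z * b j) := by
  obtain ⟨b, N, him, hanti, hN, hprod⟩ := exists_sorted_reciprocal_roots h0 hp
  obtain ⟨-, e1, e2⟩ := coeff_prod_one_sub b N
  have hq1 : ∑ j ∈ Finset.range N, b j = -(p.coeff 1 / p.coeff 0) := by
    have : p.coeff 1 = p.coeff 0 * -∑ j ∈ Finset.range N, b j := by
      conv_lhs => rw [hprod]
      rw [coeff_C_mul, e1]
    rw [this]
    field_simp
  have hq2 : ∑ j ∈ Finset.range N, b j ^ 2 =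
      (p.coeff 1 / p.coeff 0) ^ 2 - 2 * (p.coeff 2 / p.coeff 0) := by
    have : p.coeff 2 / p.coeff 0 = (∏ j ∈ Finset.range N, (1 - C (b j) * X)).coeff 2 := by
      rw [div_eq_iff h0]
      conv_lhs => rw [hprod]
      rw [coeff_C_mul, mul_comm]
    rw [this, e2, hq1]
    ring
  have hz : ∀ j ∉ Finset.range N, b j = 0 := fun j hj => hN j (by simpa using hj)
  refine ⟨b, N, ∑ j ∈ Finset.range N, ‖b j‖ ^ 2, him, hanti, hN, ?_, ?_, ?_, ?_, ?_⟩
  · rw [← hq1]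
    exact hasSum_sum_of_ne_finset_zero hz
  · rw [← hq2]
    exact hasSum_sum_of_ne_finset_zero fun j hj => by simp [hz j hj]
  · exact hasSum_sum_of_ne_finset_zero fun j hj => by simp [hz j hj]
  · have hsq : ∀ j, ‖b j‖ ^ 2 = (b j ^ 2).re + 2 * (-(b j).im) ^ 2 := by
      intro j
      rw [Complex.sq_norm, Complex.normSq_apply, sq (b j), Complex.mul_re]
      ring
    have him2 : ∑ j ∈ Finset.range N, (-(b j).im) ^ 2 ≤ ‖p.coeff 1 / p.coeff 0‖ ^ 2 := by
      calc _ ≤ (∑ j ∈ Finset.range N, -(b j).im) ^ 2 :=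
            Finset.sum_sq_le_sq_sum_of_nonneg fun j _ => neg_nonneg.2 (him j)
        _ = (p.coeff 1 / p.coeff 0).im ^ 2 := by
            rw [Finset.sum_neg_distrib, ← Complex.im_sum, hq1, Complex.neg_im, neg_neg]
        _ ≤ _ := by
            rw [← sq_abs]
            gcongr
            exact Complex.abs_im_le_norm _
    simp_rw [hsq]
    rw [Finset.sum_add_distrib, ← Complex.re_sum, ← Finset.mul_sum, hq2]
    have h3 : ((p.coeff 1 / p.coeff 0) ^ 2 - 2 * (p.coeff 2 / p.coeff 0)).re ≤
        ‖p.coeff 1 / p.coeff 0‖ ^ 2 + 2 * ‖p.coeff 2 / p.coeff 0‖ := by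
      refine (Complex.re_le_norm _).trans ((norm_sub_le _ _).trans ?_)
      rw [norm_pow, norm_mul, Complex.norm_ofNat]
    linarith
  · intro z
    conv_lhs => rw [hprod]
    rw [eval_mul, eval_C, eval_prod]
    congr 1
    refine Finset.prod_congr rfl fun j _ => ?_
    rw [eval_sub, eval_one, eval_mul, eval_C, eval_X, mul_comm]

open Polynomial in
theorem norm_eval_le_of_roots_im_nonneg {p : ℂ[X]} (h0 : p.coeff 0 ≠ 0)
    (hp : ∀ a ∈ p.roots, 0 ≤ a.im) (z : ℂ) :
    ‖p.eval z‖ ≤ ‖p.coeff 0‖ * Real.exp (‖p.coeff 1 / p.coeff 0‖ * ‖z‖ +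
      (3 * ‖p.coeff 1 / p.coeff 0‖ ^ 2 + 2 * ‖p.coeff 2 / p.coeff 0‖) * ‖z‖ ^ 2 / 2) := by
  obtain ⟨b, N, T, -, -, hN, hs1, -, hsT, hT, heval⟩ := exists_reciprocal_roots h0 hp
  have hz : ∀ j ∉ Finset.range N, b j = 0 := fun j hj => hN j (by simpa using hj)
  have e1 : ∑ j ∈ Finset.range N, b j = -(p.coeff 1 / p.coeff 0) :=
    (hasSum_sum_of_ne_finset_zero hz).unique hs1
  have eT : ∑ j ∈ Finset.range N, ‖b j‖ ^ 2 ≤ T :=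
    sum_le_hasSum _ (fun _ _ => by positivity) hsT
  have hE : p.eval z = p.coeff 0 * (Complex.exp (p.coeff 1 / p.coeff 0 * z) *
      ∏ j ∈ Finset.range N, ((1 - z * b j) * Complex.exp (z * b j))) := by
    have he : Complex.exp (p.coeff 1 / p.coeff 0 * z) *
        Complex.exp (z * -(p.coeff 1 / p.coeff 0)) = 1 := by
      rw [← Complex.exp_add, mul_comm z, neg_mul, add_neg_cancel, Complex.exp_zero]
    rw [heval, Finset.prod_mul_distrib, ← Complex.exp_sum, ← Finset.mul_sum, e1]
    linear_combination (-(p.coeff 0 * ∏ j ∈ Finset.range N, (1 - z * b j))) * he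
  rw [hE, norm_mul, norm_mul, Complex.norm_exp, norm_prod, Real.exp_add]
  gcongr
  · exact (Complex.re_le_norm _).trans (norm_mul_le _ _)
  · calc _ ≤ ∏ j ∈ Finset.range N, Real.exp (‖z * b j‖ ^ 2 / 2) :=
          Finset.prod_le_prod (fun _ _ => norm_nonneg _) fun _ _ => norm_one_sub_mul_exp_le _
      _ = Real.exp ((∑ j ∈ Finset.range N, ‖b j‖ ^ 2) * ‖z‖ ^ 2 / 2) := by
          rw [← Real.exp_sum, Finset.sum_mul, Finset.sum_div]
          congr 1
          refine Finset.sum_congr rfl fun j _ => ?_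
          rw [norm_mul]
          ring
      _ ≤ _ := by
          gcongr
          exact eT.trans hT

/-! ### Weakly convergent sequences converge locally uniformly -/

open Polynomial in
theorem iteratedDeriv_eval_zero (p : ℂ[X]) (k : ℕ) :
    iteratedDeriv k (fun z => p.eval z) 0 = k.factorial * p.coeff k := by
  have h : ∀ k : ℕ, iteratedDeriv k (fun z => p.eval z) = fun z => (derivative^[k] p).eval z := by
    intro k
    induction k with
    | zero => simp
    | succ k ih =>
      rw [iteratedDeriv_succ, ih, Function.iterate_succ_apply']
      funext z
      exact Polynomial.deriv _
  simp only [h]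
  rw [← coeff_zero_eq_eval_zero, coeff_iterate_derivative, zero_add, Nat.descFactorial_self,
    nsmul_eq_mul]

open Polynomial in
theorem norm_coeff_le_of_norm_eval_le {p : ℂ[X]} {R M : ℝ} (hR : 0 < R)
    (h : ∀ z : ℂ, ‖z‖ = R → ‖p.eval z‖ ≤ M) (k : ℕ) : ‖p.coeff k‖ ≤ M / R ^ k := by
  have := Complex.norm_iteratedDeriv_le_of_forall_mem_sphere_norm_le (c := 0) (C := M) k hR
    (f := fun z => p.eval z) p.differentiable.diffContOnCl (fun z hz => h z (by simpa using hz))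
  rw [iteratedDeriv_eval_zero, norm_mul, Complex.norm_natCast, mul_div_assoc] at this
  exact le_of_mul_le_mul_left this (by positivity)

open Polynomial in
/-- Differentiating `m` times removes the vanishing low order coefficients of the limit, and keeps
the zeros in the half plane by the Gauss-Lucas theorem. -/
theorem exists_eventually_norm_coeff_le {l : Filter ℕ} {P : ℕ → ℂ[X]} {c : ℕ → ℂ}
    (hroots : ∀ᶠ n in l, ∀ a ∈ (P n).roots, 0 ≤ a.im)
    (hc : ∀ k, Tendsto (fun n => (P n).coeff k) l (𝓝 (c k))) {m : ℕ} (hm : c m ≠ 0)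
    {R : ℝ} (hR : 0 < R) : ∃ M, ∀ᶠ n in l, ∀ k, ‖(P n).coeff k‖ ≤ M / R ^ k := by
  set Q : ℕ → ℂ[X] := fun n => derivative^[m] (P n) with hQ
  set d : ℕ → ℂ := fun k => ((k + m).descFactorial m : ℂ) * c (k + m) with hd
  have hQc : ∀ k, Tendsto (fun n => (Q n).coeff k) l (𝓝 (d k)) := by
    intro k
    simp only [hQ, coeff_iterate_derivative, nsmul_eq_mul]
    exact (hc _).const_mul _
  have hd0 : d 0 ≠ 0 := by
    simp only [hd, zero_add, Nat.descFactorial_self]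
    exact mul_ne_zero (by exact_mod_cast m.factorial_ne_zero) hm
  have hQroots : ∀ᶠ n in l, ∀ a ∈ (Q n).roots, 0 ≤ a.im := by
    filter_upwards [hroots] with n hn
    have : ∀ i, ∀ a ∈ (derivative^[i] (P n)).roots, 0 ≤ a.im := by
      intro i
      induction i with
      | zero => exact hn
      | succ i ih =>
        rw [Function.iterate_succ_apply']
        exact roots_derivative_im_nonneg ih
    exact this m
  have hlim : Tendsto (fun n => ‖(Q n).coeff 0‖ * Real.exp (‖(Q n).coeff 1 / (Q n).coeff 0‖ * R +
      (3 * ‖(Q n).coeff 1 / (Q n).coeff 0‖ ^ 2 + 2 * ‖(Q n).coeff 2 / (Q n).coeff 0‖)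
        * R ^ 2 / 2)) l (𝓝 (‖d 0‖ * Real.exp (‖d 1 / d 0‖ * R +
      (3 * ‖d 1 / d 0‖ ^ 2 + 2 * ‖d 2 / d 0‖) * R ^ 2 / 2))) := by
    have t1 := ((hQc 1).div (hQc 0) hd0).norm
    have t2 := ((hQc 2).div (hQc 0) hd0).norm
    exact (hQc 0).norm.mul (Real.continuous_exp.continuousAt.tendsto.comp
      ((t1.mul_const R).add (((((t1.pow 2).const_mul 3).add (t2.const_mul 2)).mul_const _).div_const
        2)))
  obtain ⟨M₁, hM₁⟩ : ∃ M₁, ∀ᶠ n in l, ∀ k, ‖(Q n).coeff k‖ ≤ M₁ / R ^ k := by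
    obtain ⟨M₁, hle⟩ := hlim.isBoundedUnder_le.eventually_le
    refine ⟨M₁, ?_⟩
    filter_upwards [hQroots, (hQc 0).eventually_ne hd0, hle] with n h1 h2 h3 k
    refine norm_coeff_le_of_norm_eval_le hR (fun z hz => ?_) k
    have := norm_eval_le_of_roots_im_nonneg h2 h1 z
    rw [hz] at this
    exact this.trans h3
  have hlow : ∀ᶠ n in l, ∀ k ∈ Finset.range m, ‖(P n).coeff k‖ ≤ ‖c k‖ + 1 :=
    (Filter.eventually_all_finset _).2 fun k _ => (hc k).norm.eventually_le_const (lt_add_one _)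
  refine ⟨|M₁| * R ^ m + ∑ k ∈ Finset.range m, (‖c k‖ + 1) * R ^ k, ?_⟩
  filter_upwards [hM₁, hlow] with n h1 h2 k
  have hpos : ∀ k, 0 ≤ (‖c k‖ + 1) * R ^ k := fun k => by positivity
  rw [le_div_iff₀ (pow_pos hR k)]
  rcases lt_or_ge k m with hk | hk
  · have h3 := h2 k (Finset.mem_range.2 hk)
    calc _ ≤ (‖c k‖ + 1) * R ^ k := by gcongr
      _ ≤ ∑ k ∈ Finset.range m, (‖c k‖ + 1) * R ^ k :=
        Finset.single_le_sum (f := fun k => (‖c k‖ + 1) * R ^ k) (fun i _ => hpos i)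
          (Finset.mem_range.2 hk)
      _ ≤ _ := le_add_of_nonneg_left (by positivity)
  · obtain ⟨i, rfl⟩ := Nat.exists_eq_add_of_le' hk
    have h3 := h1 i
    rw [le_div_iff₀ (pow_pos hR i)] at h3
    have h4 : ‖(P n).coeff (i + m)‖ ≤ ‖(Q n).coeff i‖ := by
      simp only [hQ, coeff_iterate_derivative, nsmul_eq_mul, norm_mul, Complex.norm_natCast]
      refine le_mul_of_one_le_left (norm_nonneg _) ?_
      exact_mod_cast Nat.succ_le_of_lt (Nat.descFactorial_pos.2 (Nat.le_add_left m i))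
    calc ‖(P n).coeff (i + m)‖ * R ^ (i + m) = ‖(P n).coeff (i + m)‖ * R ^ i * R ^ m := by ring
      _ ≤ ‖(Q n).coeff i‖ * R ^ i * R ^ m := by gcongr
      _ ≤ |M₁| * R ^ m := by gcongr; exact h3.trans (le_abs_self _)
      _ ≤ _ := le_add_of_nonneg_right (Finset.sum_nonneg fun i _ => hpos i)

open Polynomial in
theorem hasSum_coeff_mul_pow (p : ℂ[X]) (z : ℂ) :
    HasSum (fun k => p.coeff k * z ^ k) (p.eval z) := by
  rw [eval_eq_sum_range]
  refine hasSum_sum_of_ne_finset_zero fun k hk => ?_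
  rw [coeff_eq_zero_of_natDegree_lt (by simpa using hk), zero_mul]

section

variable {l : Filter ℕ} [l.NeBot] {P : ℕ → Polynomial ℂ} {c : ℕ → ℂ}

theorem summable_norm_coeff_mul_pow
    (hroots : ∀ᶠ n in l, ∀ a ∈ (P n).roots, 0 ≤ a.im)
    (hc : ∀ k, Tendsto (fun n => (P n).coeff k) l (𝓝 (c k))) {m : ℕ} (hm : c m ≠ 0) (r : ℝ) :
    Summable fun k => ‖c k‖ * r ^ k := by
  have hR : 0 < |r| + 1 := by positivity
  obtain ⟨M, hM⟩ := exists_eventually_norm_coeff_le hroots hc hm hR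
  have hcM : ∀ k, ‖c k‖ ≤ M / (|r| + 1) ^ k := fun k =>
    le_of_tendsto (hc k).norm (hM.mono fun n hn => hn k)
  refine Summable.of_norm_bounded (g := fun k => M * (|r| / (|r| + 1)) ^ k)
    ((summable_geometric_of_lt_one (by positivity) ?_).mul_left _) fun k => ?_
  · rw [div_lt_one hR]
    linarith
  · rw [norm_mul, norm_norm, norm_pow, Real.norm_eq_abs, div_pow, ← mul_div_assoc, mul_comm M,
      mul_div_assoc, mul_comm]
    gcongr
    exact hcM k

theorem hasSum_limit_coeff_mul_pow
    (hroots : ∀ᶠ n in l, ∀ a ∈ (P n).roots, 0 ≤ a.im)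
    (hc : ∀ k, Tendsto (fun n => (P n).coeff k) l (𝓝 (c k))) {m : ℕ} (hm : c m ≠ 0) (z : ℂ) :
    HasSum (fun k => c k * z ^ k) (∑' k, c k * z ^ k) := by
  refine (Summable.of_norm ?_).hasSum
  simpa only [norm_mul, norm_pow] using summable_norm_coeff_mul_pow hroots hc hm ‖z‖

theorem tendstoUniformlyOn_eval_tsum
    (hroots : ∀ᶠ n in l, ∀ a ∈ (P n).roots, 0 ≤ a.im)
    (hc : ∀ k, Tendsto (fun n => (P n).coeff k) l (𝓝 (c k))) {m : ℕ} (hm : c m ≠ 0) (r : ℝ) :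
    TendstoUniformlyOn (fun n z => (P n).eval z) (fun z => ∑' k, c k * z ^ k) l
      (Metric.closedBall 0 r) := by
  have hR : 0 < |r| + 1 := by positivity
  obtain ⟨M, hM⟩ := exists_eventually_norm_coeff_le hroots hc hm hR
  have hcM : ∀ k, ‖c k‖ ≤ M / (|r| + 1) ^ k := fun k =>
    le_of_tendsto (hc k).norm (hM.mono fun n hn => hn k)
  have hbound : Summable fun k : ℕ => (M + M) * (|r| / (|r| + 1)) ^ k := by
    refine (summable_geometric_of_lt_one (by positivity) ?_).mul_left _
    rw [div_lt_one hR]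
    linarith
  have hdom : ∀ᶠ n in l, ∀ k, ‖‖c k - (P n).coeff k‖ * |r| ^ k‖ ≤
      (M + M) * (|r| / (|r| + 1)) ^ k := by
    filter_upwards [hM] with n hn k
    rw [norm_mul, norm_norm, norm_pow, Real.norm_eq_abs, abs_abs, div_pow, ← mul_div_assoc,
      mul_comm (M + M), mul_div_assoc, mul_comm, add_div]
    gcongr
    exact (norm_sub_le _ _).trans (add_le_add (hcM k) (hn k))
  have hlim : Tendsto (fun n => ∑' k, ‖c k - (P n).coeff k‖ * |r| ^ k) l (𝓝 0) := by
    have := tendsto_tsum_of_dominated_convergence (𝓕 := l)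
      (f := fun n k => ‖c k - (P n).coeff k‖ * |r| ^ k) (g := fun _ => (0 : ℝ)) hbound
      (fun k => by simpa using (((hc k).const_sub (c k)).norm.mul_const (|r| ^ k))) hdom
    simpa using this
  rw [Metric.tendstoUniformlyOn_iff]
  intro ε hε
  filter_upwards [hlim.eventually_lt_const hε, hdom] with n hn hd z hz
  have hz : ‖z‖ ≤ |r| := by
    have : ‖z‖ ≤ r := by simpa using hz
    exact this.trans (le_abs_self r)
  have hs := (hasSum_limit_coeff_mul_pow hroots hc hm z).sub (hasSum_coeff_mul_pow (P n) z)
  rw [dist_eq_norm, ← hs.tsum_eq]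
  refine (tsum_of_norm_bounded (Summable.of_norm_bounded hbound hd).hasSum fun k => ?_).trans_lt hn
  rw [← sub_mul, norm_mul, norm_pow]
  gcongr

theorem tendsto_eval_tsum
    (hroots : ∀ᶠ n in l, ∀ a ∈ (P n).roots, 0 ≤ a.im)
    (hc : ∀ k, Tendsto (fun n => (P n).coeff k) l (𝓝 (c k))) {m : ℕ} (hm : c m ≠ 0) (z : ℂ) :
    Tendsto (fun n => (P n).eval z) l (𝓝 (∑' k, c k * z ^ k)) :=
  (tendstoUniformlyOn_eval_tsum hroots hc hm ‖z‖).tendsto_at (by simp)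

theorem differentiable_tsum_limit_coeff
    (hroots : ∀ᶠ n in l, ∀ a ∈ (P n).roots, 0 ≤ a.im)
    (hc : ∀ k, Tendsto (fun n => (P n).coeff k) l (𝓝 (c k))) {m : ℕ} (hm : c m ≠ 0) :
    Differentiable ℂ fun z => ∑' k, c k * z ^ k := by
  rw [← differentiableOn_univ]
  refine TendstoLocallyUniformlyOn.differentiableOn (φ := l) (F := fun n z => (P n).eval z) ?_
    (Eventually.of_forall fun n => (P n).differentiable.differentiableOn) isOpen_univ
  rw [tendstoLocallyUniformlyOn_iff_forall_isCompact isOpen_univ]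
  intro K _ hK
  obtain ⟨r, hr⟩ := hK.isBounded.subset_closedBall (0 : ℂ)
  exact (tendstoUniformlyOn_eval_tsum hroots hc hm r).mono hr

end

/-! ### Limits of sums along a filter -/

theorem summable_and_tsum_le_of_tendsto {l : Filter ℕ} [l.NeBot] {x : ℕ → ℕ → ℝ} {X : ℕ → ℝ}
    {y : ℕ → ℝ} {L : ℝ} (hx : ∀ᶠ n in l, (∀ j, 0 ≤ x n j) ∧ HasSum (x n) (X n))
    (hxy : ∀ j, Tendsto (fun n => x n j) l (𝓝 (y j))) (hX : Tendsto X l (𝓝 L)) :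
    Summable y ∧ ∑' j, y j ≤ L := by
  have hy : ∀ j, 0 ≤ y j := fun j => ge_of_tendsto (hxy j) (hx.mono fun n hn => hn.1 j)
  have hs : ∀ s : Finset ℕ, ∑ j ∈ s, y j ≤ L := fun s =>
    le_of_tendsto_of_tendsto (tendsto_finsetSum s fun j _ => hxy j) hX
      (hx.mono fun n hn => sum_le_hasSum s (fun j _ => hn.1 j) hn.2)
  have h := summable_of_sum_le hy hs
  exact ⟨h, h.tsum_le_of_sum_le hs⟩

/-- Interchange of limit and sum when the tails of the sums are uniformly small, being bounded by
`t J * Y` with `t J → 0`. -/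
theorem tendsto_of_hasSum_of_norm_le_mul {l : Filter ℕ} {x : ℕ → ℕ → ℂ} {X : ℕ → ℂ}
    {y : ℕ → ℂ} {w : ℕ → ℕ → ℝ} {t : ℕ → ℝ} {Y : ℝ}
    (hx : ∀ᶠ n in l, HasSum (x n) (X n) ∧ (∀ j, 0 ≤ w n j) ∧ (∃ W ≤ Y, HasSum (w n) W) ∧
      ∀ j, ‖x n j‖ ≤ t j * w n j)
    (ht : Antitone t) (ht0 : Tendsto t atTop (𝓝 0)) (hy : Summable y)
    (hxy : ∀ j, Tendsto (fun n => x n j) l (𝓝 (y j))) :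
    Tendsto X l (𝓝 (∑' j, y j)) := by
  have htail : ∀ᶠ n in l, ∀ J, ‖X n - ∑ j ∈ Finset.range J, x n j‖ ≤ t J * Y := by
    filter_upwards [hx] with n ⟨h1, h2, ⟨W, hWY, hW⟩, h4⟩ J
    have hw : Summable fun j => w n (j + J) := (summable_nat_add_iff J).2 hW.summable
    have hwW : ∑' j, w n (j + J) ≤ W := by
      rw [← hW.tsum_eq, ← hW.summable.sum_add_tsum_nat_add J]
      exact le_add_of_nonneg_left (Finset.sum_nonneg fun j _ => h2 j)
    rw [← h1.tsum_eq, ← h1.summable.sum_add_tsum_nat_add J, add_sub_cancel_left]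
    refine (tsum_of_norm_bounded (hw.hasSum.mul_left (t J)) fun j => ?_).trans ?_
    · exact (h4 _).trans (mul_le_mul_of_nonneg_right (ht (Nat.le_add_left J j)) (h2 _))
    · exact mul_le_mul_of_nonneg_left (hwW.trans hWY) (ht.le_of_tendsto ht0 J)
  have hunif : TendstoUniformlyOnFilter (fun J n => ∑ j ∈ Finset.range J, x n j) X atTop l := by
    rw [Metric.tendstoUniformlyOnFilter_iff]
    intro ε hε
    have h0 : Tendsto (fun J => t J * Y) atTop (𝓝 0) := by simpa using ht0.mul_const Y
    filter_upwards [(h0.eventually_lt_const hε).prod_mk htail] with ⟨J, n⟩ ⟨h1, h2⟩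
    rw [dist_eq_norm]
    exact (h2 J).trans_lt h1
  exact hunif.tendsto_of_eventually_tendsto
    (Eventually.of_forall fun J => tendsto_finsetSum _ fun j _ => hxy j)
    hy.hasSum.tendsto_sum_nat

theorem sq_norm_mul_succ_le_of_antitone {b : ℕ → ℂ} {T : ℝ} (hanti : Antitone fun j => ‖b j‖)
    (hT : HasSum (fun j => ‖b j‖ ^ 2) T) (j : ℕ) : ‖b j‖ ^ 2 ≤ T / (j + 1) := by
  rw [le_div_iff₀ (by positivity)]
  calc ‖b j‖ ^ 2 * (j + 1) = ∑ _i ∈ Finset.range (j + 1), ‖b j‖ ^ 2 := by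
        simp
        ring
    _ ≤ ∑ i ∈ Finset.range (j + 1), ‖b i‖ ^ 2 := by
        refine Finset.sum_le_sum fun i hi => ?_
        gcongr
        exact hanti (Nat.lt_succ_iff.1 (Finset.mem_range.1 hi))
    _ ≤ T := sum_le_hasSum _ (fun _ _ => by positivity) hT

/-! ### The limit when its value at the origin is nonzero -/

/-- The genus two factors `(1 - w) exp (w + w² / 2)` are `1 + O(w³)`, and `∑ |b|³` converges uniformly
because the sorted `j`-th reciprocal root is `O(j ^ (-1/2))`. -/
theorem tendsto_tprod_genus_two {l : Filter ℕ} {b : ℕ → ℕ → ℂ} {b' : ℕ → ℂ} {B : ℝ} (hB : 0 ≤ B)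
    (hb : ∀ᶠ n in l, ∀ j : ℕ, ‖b n j‖ ^ 2 ≤ B / (j + 1))
    (hlim : ∀ j, Tendsto (fun n => b n j) l (𝓝 (b' j))) (z : ℂ) :
    Tendsto (fun n => ∏' j, ((1 - z * b n j) * Complex.exp (z * b n j + (z * b n j) ^ 2 / 2))) l
      (𝓝 (∏' j, ((1 - z * b' j) * Complex.exp (z * b' j + (z * b' j) ^ 2 / 2)))) := by
  set K : ℝ := Real.exp (‖z‖ * √B + (‖z‖ * √B) ^ 2 / 2) with hK
  have hsum : Summable fun j : ℕ => (‖z‖ * √B) ^ 3 * K * (1 / ((j : ℝ) + 1) ^ (3 / 2 : ℝ)) := by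
    refine Summable.mul_left _ ?_
    have := (summable_nat_add_iff 1).2 (Real.summable_one_div_nat_rpow.2
      (show (1 : ℝ) < 3 / 2 by norm_num))
    simpa using this
  have key := tendsto_tprod_one_add_of_dominated_convergence (𝓕 := l)
    (f := fun n j => (1 - z * b n j) * Complex.exp (z * b n j + (z * b n j) ^ 2 / 2) - 1)
    (g := fun j => (1 - z * b' j) * Complex.exp (z * b' j + (z * b' j) ^ 2 / 2) - 1)
    hsum (fun j => ?_) ?_
  · simpa using key
  · have h := (hlim j).const_mul z
    exact ((h.const_sub 1).mul ((Complex.continuous_exp.continuousAt.tendsto).comp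
      (h.add ((h.pow 2).div_const 2)))).sub_const 1
  · filter_upwards [hb] with n hn j
    have h1 : ‖b n j‖ ≤ √B / √((j : ℝ) + 1) := by
      rw [← Real.sqrt_div hB]
      exact Real.le_sqrt_of_sq_le (hn j)
    have h1' : ‖b n j‖ ≤ √B := h1.trans (div_le_self (Real.sqrt_nonneg _)
      (Real.one_le_sqrt.2 (by linarith [(Nat.cast_nonneg j : (0 : ℝ) ≤ j)])))
    have h2 : ((j : ℝ) + 1) ^ (3 / 2 : ℝ) = √((j : ℝ) + 1) ^ 3 := by
      rw [Real.sqrt_eq_rpow, ← Real.rpow_natCast, ← Real.rpow_mul (by positivity)]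
      norm_num
    calc _ ≤ _ := norm_one_sub_mul_exp_add_sq_sub_one_le _
      _ ≤ (‖z‖ * (√B / √((j : ℝ) + 1))) ^ 3 * K := by
          rw [hK, norm_mul]
          gcongr
      _ = _ := by
          rw [h2]
          ring

open Polynomial in
/-- The exponent `α` is half of the loss of mass `lim ∑ⱼ |b_{n,j}|² - ∑ⱼ |b_j|²`: the sums
`∑ⱼ b_{n,j} Im b_{n,j}` pass to the limit without loss, and `|b|² = b² - 2 i b Im b`. -/
theorem exists_tendsto_eval_of_coeff_zero_ne_zero {U : Ultrafilter ℕ} {P : ℕ → ℂ[X]} {c : ℕ → ℂ}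
    (hroots : ∀ᶠ n in U, ∀ a ∈ (P n).roots, 0 ≤ a.im)
    (hc : ∀ k, Tendsto (fun n => (P n).coeff k) U (𝓝 (c k))) (h0 : c 0 ≠ 0) :
    ∃ (α : ℝ) (β : ℂ) (b : ℕ → ℂ), 0 ≤ α ∧ (∀ j, (b j).im ≤ 0) ∧
      (Summable fun j => ‖b j‖ ^ 2) ∧ (Summable fun j => (-b j).im) ∧
      ∑' j, (-b j).im ≤ β.im ∧
      ∀ z, Tendsto (fun n => (P n).eval z) U (𝓝 (c 0 * Complex.exp (-(α : ℂ) * z ^ 2 + β * z) *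
        ∏' j, ((1 - z * b j) * Complex.exp (z * b j)))) := by
  have hex : ∀ n, ∃ (b : ℕ → ℂ) (N : ℕ) (T : ℝ), (P n).coeff 0 ≠ 0 ∧
      (∀ a ∈ (P n).roots, 0 ≤ a.im) → (∀ j, (b j).im ≤ 0) ∧ Antitone (fun j => ‖b j‖) ∧
      (∀ j, N ≤ j → b j = 0) ∧
      HasSum b (-((P n).coeff 1 / (P n).coeff 0)) ∧
      HasSum (fun j => b j ^ 2)
        (((P n).coeff 1 / (P n).coeff 0) ^ 2 - 2 * ((P n).coeff 2 / (P n).coeff 0)) ∧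
      HasSum (fun j => ‖b j‖ ^ 2) T ∧
      T ≤ 3 * ‖(P n).coeff 1 / (P n).coeff 0‖ ^ 2 + 2 * ‖(P n).coeff 2 / (P n).coeff 0‖ ∧
      ∀ z, (P n).eval z = (P n).coeff 0 * ∏ j ∈ Finset.range N, (1 - z * b j) := by
    intro n
    by_cases h : (P n).coeff 0 ≠ 0 ∧ ∀ a ∈ (P n).roots, 0 ≤ a.im
    · obtain ⟨b, N, T, hb⟩ := exists_reciprocal_roots h.1 h.2
      exact ⟨b, N, T, fun _ => hb⟩
    · exact ⟨0, 0, 0, fun h' => absurd h' h⟩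
  choose b N T hb using hex
  have hb := ((hc 0).eventually_ne h0).and hroots |>.mono hb
  set q₁ : ℕ → ℂ := fun n => (P n).coeff 1 / (P n).coeff 0 with hq₁
  set q₂ : ℕ → ℂ := fun n => (P n).coeff 2 / (P n).coeff 0 with hq₂
  have t₁ : Tendsto q₁ U (𝓝 (c 1 / c 0)) := (hc 1).div (hc 0) h0
  have t₂ : Tendsto q₂ U (𝓝 (c 2 / c 0)) := (hc 2).div (hc 0) h0
  set β := c 1 / c 0 with hβ
  set S := β ^ 2 - 2 * (c 2 / c 0) with hS
  have tS : Tendsto (fun n => q₁ n ^ 2 - 2 * q₂ n) U (𝓝 S) := (t₁.pow 2).sub (t₂.const_mul 2)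
  -- A bound for the square sums that does not depend on `n`.
  obtain ⟨B, hB⟩ : ∃ B, ∀ᶠ n in U, T n ≤ B := by
    obtain ⟨B, hB⟩ := ((t₁.norm.pow 2).const_mul 3).add
      (t₂.norm.const_mul 2) |>.isBoundedUnder_le.eventually_le
    refine ⟨B, ?_⟩
    filter_upwards [hB, hb] with n h1 h2
    exact h2.2.2.2.2.2.2.1.trans h1
  have hbB : ∀ᶠ n in U, ∀ j : ℕ, ‖b n j‖ ^ 2 ≤ B / (j + 1) := by
    filter_upwards [hb, hB] with n h1 h2 j
    refine (sq_norm_mul_succ_le_of_antitone h1.2.1 h1.2.2.2.2.2.1 j).trans ?_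
    gcongr
  have hB0 : 0 ≤ B := by
    obtain ⟨n, hn⟩ := hbB.exists
    have := (sq_nonneg _).trans (hn 0)
    simpa using this
  -- Every bounded sequence converges along the ultrafilter.
  have hlim : ∀ j, ∃ b', Tendsto (fun n => b n j) U (𝓝 b') := by
    intro j
    have hmem : ∀ᶠ n in U, b n j ∈ Metric.closedBall (0 : ℂ) √B := by
      filter_upwards [hbB] with n hn
      rw [mem_closedBall_zero_iff]
      refine Real.le_sqrt_of_sq_le ((hn j).trans (div_le_self hB0 ?_))
      linarith [(Nat.cast_nonneg j : (0 : ℝ) ≤ j)]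
    obtain ⟨b', -, h⟩ := (isCompact_closedBall (0 : ℂ) √B).ultrafilter_le_nhds
      (U.map fun n => b n j) (le_principal_iff.2 hmem)
    exact ⟨b', h⟩
  choose b' hb' using hlim
  have him' : ∀ j, (b' j).im ≤ 0 := fun j =>
    le_of_tendsto ((Complex.continuous_im.tendsto _).comp (hb' j)) (hb.mono fun n hn => hn.1 j)
  have hI := summable_and_tsum_le_of_tendsto (l := (U : Filter ℕ)) (x := fun n j => (-b n j).im)
    (X := fun n => (q₁ n).im) (y := fun j => (-b' j).im) (L := β.im)
    (hb.mono fun n hn => ⟨fun j => by simpa using hn.1 j, by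
      have := Complex.hasSum_im hn.2.2.2.1.neg
      rwa [neg_neg] at this⟩)
    (fun j => (Complex.continuous_im.tendsto _).comp (hb' j).neg)
    ((Complex.continuous_im.tendsto _).comp t₁)
  have hsq' : Summable fun j => ‖b' j‖ ^ 2 := by
    refine summable_of_sum_le (c := B) (fun j => by positivity) fun s => ?_
    refine le_of_tendsto (tendsto_finsetSum s fun j _ => (hb' j).norm.pow 2) ?_
    filter_upwards [hb, hB] with n h1 h2
    exact (sum_le_hasSum s (fun j _ => by positivity) h1.2.2.2.2.2.1).trans h2
  have hsqc : Summable fun j => b' j ^ 2 := Summable.of_norm (by simpa using hsq')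
  have hbim : Summable fun j => b' j * ((b' j).im : ℂ) := by
    refine Summable.of_norm_bounded hsq' fun j => ?_
    rw [norm_mul, Complex.norm_real, sq, Real.norm_eq_abs]
    gcongr
    exact Complex.abs_im_le_norm _
  have hnormsq : ∀ w : ℂ, ((‖w‖ ^ 2 : ℝ) : ℂ) = w ^ 2 - 2 * Complex.I * (w * (w.im : ℂ)) := by
    intro w
    rw [Complex.sq_norm, Complex.normSq_apply]
    refine Complex.ext ?_ ?_ <;> simp [sq] <;> ring
  -- Convergence of the mixed sums, whose tails are dominated by those of `∑ |Im b|`.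
  have hmixed : Tendsto (fun n => ((q₁ n ^ 2 - 2 * q₂ n) - (T n : ℂ)) / (2 * Complex.I)) U
      (𝓝 (∑' j, b' j * ((b' j).im : ℂ))) := by
    refine tendsto_of_hasSum_of_norm_le_mul (x := fun n j => b n j * ((b n j).im : ℂ))
      (w := fun n j => (-b n j).im) (t := fun j => √(B / (j + 1))) (Y := β.im + 1) ?_ ?_ ?_ hbim ?_
    · filter_upwards [hb, hbB, ((Complex.continuous_im.tendsto _).comp t₁).eventually_le_const
        (lt_add_one _)] with n hn hnB hn1
      refine ⟨?_, fun j => by simpa using hn.1 j, ⟨(q₁ n).im, hn1, ?_⟩, fun j => ?_⟩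
      · have h := (hn.2.2.2.2.1.sub (Complex.hasSum_ofReal.2 hn.2.2.2.2.2.1)).div_const
          (2 * Complex.I)
        have hfun : (fun j => b n j * ((b n j).im : ℂ)) =
            fun j => (b n j ^ 2 - ((‖b n j‖ ^ 2 : ℝ) : ℂ)) / (2 * Complex.I) := by
          funext j
          rw [hnormsq]
          field_simp
          ring
        simp only [hfun]
        exact h
      · have := Complex.hasSum_im hn.2.2.2.1.neg
        rwa [neg_neg] at this
      · rw [norm_mul, Complex.norm_real, Complex.neg_im, Real.norm_eq_abs,
          abs_of_nonpos (hn.1 j)]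
        exact mul_le_mul_of_nonneg_right (Real.le_sqrt_of_sq_le (hnB j)) (neg_nonneg.2 (hn.1 j))
    · intro i j hij
      dsimp only
      gcongr
    · have := (tendsto_const_div_atTop_nhds_zero_nat B).comp (tendsto_add_atTop_nat 1)
      simpa [Function.comp_def] using this.sqrt
    · exact fun j => (hb' j).mul
        ((Complex.continuous_ofReal.comp Complex.continuous_im).tendsto _ |>.comp (hb' j))
  have hTlim : Tendsto (fun n => (T n : ℂ)) U
      (𝓝 (S - 2 * Complex.I * ∑' j, b' j * ((b' j).im : ℂ))) := by
    refine (tS.sub (hmixed.const_mul (2 * Complex.I))).congr fun n => ?_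
    field_simp
    ring
  have hS2 : S - 2 * Complex.I * ∑' j, b' j * ((b' j).im : ℂ) =
      S - ∑' j, b' j ^ 2 + ((∑' j, ‖b' j‖ ^ 2 : ℝ) : ℂ) := by
    rw [Complex.ofReal_tsum]
    simp_rw [hnormsq]
    rw [hsqc.tsum_sub (hbim.mul_left _), tsum_mul_left]
    ring
  rw [hS2] at hTlim
  have hTre := (Complex.continuous_re.tendsto _).comp hTlim
  have hTim := (Complex.continuous_im.tendsto _).comp hTlim
  simp only [Function.comp_def, Complex.ofReal_re, Complex.ofReal_im, Complex.add_re,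
    Complex.add_im, add_zero] at hTre hTim
  -- `S - ∑ b'²` is the loss of mass `lim T n - ∑ |b'|²`: it is real, and nonnegative by Fatou.
  have him0 : (S - ∑' j, b' j ^ 2).im = 0 := (tendsto_nhds_unique hTim tendsto_const_nhds)
  have hfatou := (summable_and_tsum_le_of_tendsto (l := (U : Filter ℕ))
    (x := fun n j => ‖b n j‖ ^ 2) (hb.mono fun n hn => ⟨fun j => by positivity,
      hn.2.2.2.2.2.1⟩) (fun j => (hb' j).norm.pow 2) hTre).2
  refine ⟨(S - ∑' j, b' j ^ 2).re / 2, β, b', by linarith, him', hsq', hI.1, hI.2, fun z => ?_⟩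
  have hα : (((S - ∑' j, b' j ^ 2).re / 2 : ℝ) : ℂ) = (S - ∑' j, b' j ^ 2) / 2 := by
    rw [Complex.ofReal_div, Complex.ofReal_ofNat]
    congr 1
    exact Complex.ext (by simp) (by simp [him0])
  have hprod' : ∏' j, ((1 - z * b' j) * Complex.exp (z * b' j + (z * b' j) ^ 2 / 2)) =
      (∏' j, ((1 - z * b' j) * Complex.exp (z * b' j))) *
        Complex.exp (z ^ 2 / 2 * ∑' j, b' j ^ 2) := by
    have h1 : HasProd (fun j => Complex.exp (z ^ 2 / 2 * b' j ^ 2))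
        (Complex.exp (z ^ 2 / 2 * ∑' j, b' j ^ 2)) := (hsqc.hasSum.mul_left _).cexp
    rw [← h1.tprod_eq, ← (multipliable_one_sub_mul_exp hsq' z).tprod_mul h1.multipliable]
    refine tprod_congr fun j => ?_
    rw [mul_assoc, ← Complex.exp_add]
    ring_nf
  -- For a polynomial the genus two product is finite, so the exponential factors can be split off.
  have heval : ∀ᶠ n in U, (P n).coeff 0 * Complex.exp (q₁ n * z -
      z ^ 2 / 2 * (q₁ n ^ 2 - 2 * q₂ n)) *
      ∏' j, ((1 - z * b n j) * Complex.exp (z * b n j + (z * b n j) ^ 2 / 2)) = (P n).eval z := by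
    filter_upwards [hb] with n hn
    have hz : ∀ j ∉ Finset.range (N n), b n j = 0 := fun j hj => hn.2.2.1 j (by simpa using hj)
    have e1 := (hasSum_sum_of_ne_finset_zero hz).unique hn.2.2.2.1
    have e2 := (hasSum_sum_of_ne_finset_zero (f := fun j => b n j ^ 2) (s := Finset.range (N n))
      fun j hj => by simp [hz j hj]).unique hn.2.2.2.2.1
    rw [tprod_eq_prod (s := Finset.range (N n)) fun j hj => by simp [hz j hj],
      Finset.prod_mul_distrib, ← Complex.exp_sum, Finset.sum_add_distrib, ← Finset.mul_sum, e1]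
    have e3 : ∑ j ∈ Finset.range (N n), (z * b n j) ^ 2 / 2 =
        z ^ 2 / 2 * (q₁ n ^ 2 - 2 * q₂ n) := by
      rw [← e2, Finset.mul_sum]
      exact Finset.sum_congr rfl fun j _ => by ring
    have e4 : Complex.exp (q₁ n * z - z ^ 2 / 2 * (q₁ n ^ 2 - 2 * q₂ n)) *
        Complex.exp (z * -q₁ n + z ^ 2 / 2 * (q₁ n ^ 2 - 2 * q₂ n)) = 1 := by
      rw [← Complex.exp_add, ← Complex.exp_zero]
      ring_nf
    rw [e3, hn.2.2.2.2.2.2.2 z]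
    linear_combination ((P n).coeff 0 * ∏ j ∈ Finset.range (N n), (1 - z * b n j)) * e4
  have hfin := (((hc 0).mul ((Complex.continuous_exp.tendsto _).comp
    ((t₁.mul_const z).sub (tS.const_mul (z ^ 2 / 2))))).mul
      (tendsto_tprod_genus_two hB0 hbB hb' z)).congr' heval
  have hexp : Complex.exp (-((S - ∑' j, b' j ^ 2) / 2) * z ^ 2 + β * z) =
      Complex.exp (β * z - z ^ 2 / 2 * S) * Complex.exp (z ^ 2 / 2 * ∑' j, b' j ^ 2) := by
    rw [← Complex.exp_add]
    ring_nf
  convert hfin using 2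
  rw [hprod', hα, hexp]
  ring

/-! ### Zeros at the origin -/

/-- A Hurwitz type statement: otherwise the maximum principle for `1 / P n` would bound `P n` away
from `0` at the origin. -/
theorem eventually_exists_mem_roots_norm_lt {l : Filter ℕ} [l.NeBot] {P : ℕ → Polynomial ℂ}
    {c : ℕ → ℂ} (hroots : ∀ᶠ n in l, ∀ a ∈ (P n).roots, 0 ≤ a.im)
    (hc : ∀ k, Tendsto (fun n => (P n).coeff k) l (𝓝 (c k))) {m : ℕ} (hm : c m ≠ 0)
    (h0 : c 0 = 0) {ε : ℝ} (hε : 0 < ε) : ∀ᶠ n in l, ∃ a ∈ (P n).roots, ‖a‖ < ε := by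
  set g : ℂ → ℂ := fun z => ∑' k, c k * z ^ k with hg
  have hgc : Continuous g := (differentiable_tsum_limit_coeff hroots hc hm).continuous
  have hps : HasFPowerSeriesAt g (FormalMultilinearSeries.ofScalars ℂ c) 0 := by
    rw [hasFPowerSeriesAt_iff]
    refine Eventually.of_forall fun z => ?_
    simpa [FormalMultilinearSeries.coeff_ofScalars, mul_comm, hg]
      using hasSum_limit_coeff_mul_pow hroots hc hm z
  have hne : FormalMultilinearSeries.ofScalars ℂ c ≠ 0 := by
    intro h
    apply hm
    rw [← FormalMultilinearSeries.coeff_ofScalars (𝕜 := ℂ) (p := c) (n := m), h]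
    rfl
  obtain ⟨δ, hδ, hball⟩ := Metric.eventually_nhds_iff.1
    (eventually_nhdsWithin_iff.1 (hps.locally_ne_zero hne))
  set r := min δ ε / 2 with hr
  have hr0 : 0 < r := by positivity
  have hrδ : r < δ := by
    have := min_le_left δ ε
    linarith
  have hrε : r < ε := by
    have := min_le_right δ ε
    linarith
  obtain ⟨w, hw, hmin⟩ := (isCompact_sphere (0 : ℂ) r).exists_isMinOn
    (NormedSpace.sphere_nonempty.2 hr0.le) hgc.norm.continuousOn
  have hw' : ‖w‖ = r := by simpa using hw
  have hgw : 0 < ‖g w‖ := norm_pos_iff.2 (hball (by simpa [hw'] using hrδ)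
    (by rw [Set.mem_compl_singleton_iff, ← norm_pos_iff, hw']; exact hr0))
  have hP0 : ∀ᶠ n in l, ‖(P n).coeff 0‖ < ‖g w‖ / 2 := by
    have := (hc 0).norm
    rw [h0, norm_zero] at this
    exact this.eventually_lt_const (half_pos hgw)
  have hunif := Metric.tendstoUniformlyOn_iff.1 (tendstoUniformlyOn_eval_tsum hroots hc hm r)
    _ (half_pos hgw)
  have hPne : ∀ᶠ n in l, (P n).coeff m ≠ 0 := (hc m).eventually_ne hm
  filter_upwards [hP0, hunif, hPne] with n h1 h2 h3
  by_contra! hno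
  have hnz : ∀ z ∈ Metric.closedBall (0 : ℂ) r, (P n).eval z ≠ 0 := by
    intro z hz hz0
    have hmem : z ∈ (P n).roots :=
      Polynomial.mem_roots'.2 ⟨fun h => h3 (by rw [h, Polynomial.coeff_zero]), hz0⟩
    have : ‖z‖ ≤ r := by simpa using hz
    linarith [hno z hmem]
  have hlow : ∀ z ∈ Metric.sphere (0 : ℂ) r, ‖g w‖ / 2 ≤ ‖(P n).eval z‖ := by
    intro z hz
    have e1 : ‖g w‖ ≤ ‖g z‖ := hmin hz
    have e2 := h2 z (Metric.sphere_subset_closedBall hz)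
    rw [dist_eq_norm] at e2
    have e3 := norm_sub_norm_le (g z) ((P n).eval z)
    linarith
  have hd : DiffContOnCl ℂ (fun z => ((P n).eval z)⁻¹) (Metric.ball 0 r) := by
    refine DiffContOnCl.inv (P n).differentiable.diffContOnCl ?_
    rwa [closure_ball _ hr0.ne']
  have hmax := Complex.norm_le_of_forall_mem_frontier_norm_le Metric.isBounded_ball hd
    (C := (‖g w‖ / 2)⁻¹) (fun z hz => ?_) (subset_closure (Metric.mem_ball_self hr0))
  · rw [norm_inv, ← Polynomial.coeff_zero_eq_eval_zero] at hmax
    have hpos : 0 < ‖(P n).coeff 0‖ := by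
      rw [Polynomial.coeff_zero_eq_eval_zero]
      exact norm_pos_iff.2 (hnz 0 (by simpa using hr0.le))
    have := (inv_le_inv₀ hpos (half_pos hgw)).1 hmax
    linarith
  · rw [frontier_ball _ hr0.ne'] at hz
    rw [norm_inv]
    exact (inv_le_inv₀ ((half_pos hgw).trans_le (hlow z hz)) (half_pos hgw)).2 (hlow z hz)

open Polynomial in
theorem exists_tendsto_root_divByMonic {l : Filter ℕ} [l.NeBot] {P : ℕ → ℂ[X]}
    {c : ℕ → ℂ} (hroots : ∀ᶠ n in l, ∀ a ∈ (P n).roots, 0 ≤ a.im)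
    (hc : ∀ k, Tendsto (fun n => (P n).coeff k) l (𝓝 (c k))) {m : ℕ} (hm : c m ≠ 0)
    (h0 : c 0 = 0) :
    ∃ (a : ℕ → ℂ) (Q : ℕ → ℂ[X]), Tendsto a l (𝓝 0) ∧
      (∀ᶠ n in l, (X - C (a n)) * Q n = P n) ∧
      (∀ᶠ n in l, ∀ x ∈ (Q n).roots, 0 ≤ x.im) ∧
      ∀ k, Tendsto (fun n => (Q n).coeff k) l (𝓝 (c (k + 1))) := by
  -- `a n` is a root of least modulus of `P n`, with no constraint where `P n` has no root.
  have hex : ∀ n, ∃ a, (∃ x, x ∈ (P n).roots) → a ∈ (P n).roots ∧ ∀ x ∈ (P n).roots, ‖a‖ ≤ ‖x‖ := by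
    intro n
    by_cases h : ∃ x, x ∈ (P n).roots
    · obtain ⟨x, hx⟩ := h
      obtain ⟨a, ha, hmin⟩ := (P n).roots.toFinset.exists_min_image (fun x => ‖x‖)
        ⟨x, Multiset.mem_toFinset.2 hx⟩
      exact ⟨a, fun _ => ⟨Multiset.mem_toFinset.1 ha, fun y hy =>
        hmin y (Multiset.mem_toFinset.2 hy)⟩⟩
    · exact ⟨0, fun h' => absurd h' h⟩
  choose a ha using hex
  have ha0 : Tendsto a l (𝓝 0) := by
    rw [Metric.tendsto_nhds]
    intro ε hε
    filter_upwards [eventually_exists_mem_roots_norm_lt hroots hc hm h0 hε] with n ⟨x, hx, hxε⟩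
    rw [dist_zero_right]
    exact ((ha n ⟨x, hx⟩).2 x hx).trans_lt hxε
  set Q : ℕ → ℂ[X] := fun n => P n /ₘ (X - C (a n)) with hQ
  have hmul : ∀ᶠ n in l, (X - C (a n)) * Q n = P n := by
    filter_upwards [eventually_exists_mem_roots_norm_lt hroots hc hm h0 one_pos] with n ⟨x, hx, _⟩
    exact mul_divByMonic_eq_iff_isRoot.2 (mem_roots'.1 (ha n ⟨x, hx⟩).1).2
  have hQroots : ∀ᶠ n in l, ∀ x ∈ (Q n).roots, 0 ≤ x.im := by
    filter_upwards [hmul, hroots, (hc m).eventually_ne hm] with n h1 h2 h3 x hx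
    have hne : P n ≠ 0 := fun h => h3 (by rw [h, coeff_zero])
    exact h2 x (Multiset.mem_of_le (roots.le_of_dvd hne (Dvd.intro_left _ h1)) hx)
  refine ⟨a, Q, ha0, hmul, hQroots, fun k => ?_⟩
  -- The coefficients of the quotients are bounded, by Cauchy's estimate on the unit circle.
  obtain ⟨G, hG⟩ := (isCompact_closedBall (0 : ℂ) 1).exists_bound_of_continuousOn
    (differentiable_tsum_limit_coeff hroots hc hm).continuous.continuousOn
  have hcoeff : ∀ᶠ n in l, ‖(Q n).coeff (k + 1)‖ ≤ 2 * (G + 1) := by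
    filter_upwards [hmul, Metric.tendstoUniformlyOn_iff.1
      (tendstoUniformlyOn_eval_tsum hroots hc hm 1) 1 one_pos,
      (by simpa using ha0.norm : Tendsto (fun n => ‖a n‖) l (𝓝 0)).eventually_le_const
        (show (0 : ℝ) < 1 / 2 by norm_num)] with n h1 h2 h3
    have := norm_coeff_le_of_norm_eval_le (p := Q n) (M := 2 * (G + 1)) one_pos (fun z hz => ?_)
      (k + 1)
    · simpa using this
    have hzmem : z ∈ Metric.closedBall (0 : ℂ) 1 := by simp [hz]
    have e1 := h2 z hzmem
    rw [dist_comm, dist_eq_norm] at e1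
    have e2 := norm_sub_norm_le ((P n).eval z) (∑' k, c k * z ^ k)
    have e3 := hG z hzmem
    have e4 : ‖z - a n‖ * ‖(Q n).eval z‖ = ‖(P n).eval z‖ := by
      rw [← norm_mul, ← h1]
      simp
    have e5 : 1 / 2 ≤ ‖z - a n‖ := by
      have := norm_sub_norm_le z (a n)
      rw [hz] at this
      linarith
    have e6 : 1 / 2 * ‖(Q n).eval z‖ ≤ ‖z - a n‖ * ‖(Q n).eval z‖ := by gcongr
    linarith
  have hz : Tendsto (fun n => a n * (Q n).coeff (k + 1)) l (𝓝 0) := by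
    have hz' : Tendsto (fun n => ‖a n‖ * (2 * (G + 1))) l (𝓝 0) := by
      simpa using ha0.norm.mul_const (2 * (G + 1))
    refine squeeze_zero_norm' ?_ hz'
    filter_upwards [hcoeff] with n hn
    rw [norm_mul]
    gcongr
  have := (hc (k + 1)).add hz
  rw [add_zero] at this
  refine this.congr' ?_
  filter_upwards [hmul] with n hn
  rw [← hn, coeff_X_sub_C_mul]
  ring

theorem exists_tendsto_eval_of_order_eq {U : Ultrafilter ℕ} (m : ℕ) :
    ∀ {P : ℕ → Polynomial ℂ} {c : ℕ → ℂ},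
    (∀ᶠ n in U, ∀ a ∈ (P n).roots, 0 ≤ a.im) →
    (∀ k, Tendsto (fun n => (P n).coeff k) U (𝓝 (c k))) → (∀ k < m, c k = 0) → c m ≠ 0 →
    ∃ (α : ℝ) (β : ℂ) (b : ℕ → ℂ), 0 ≤ α ∧ (∀ j, (b j).im ≤ 0) ∧
      (Summable fun j => ‖b j‖ ^ 2) ∧ (Summable fun j => (-b j).im) ∧
      ∑' j, (-b j).im ≤ β.im ∧
      ∀ z, Tendsto (fun n => (P n).eval z) U
        (𝓝 (c m * z ^ m * Complex.exp (-(α : ℂ) * z ^ 2 + β * z) *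
          ∏' j, ((1 - z * b j) * Complex.exp (z * b j)))) := by
  induction m with
  | zero =>
    intro P c hroots hc _ hm
    simpa using exists_tendsto_eval_of_coeff_zero_ne_zero hroots hc hm
  | succ m ih =>
    intro P c hroots hc hlow hm
    obtain ⟨a, Q, ha, hmul, hQroots, hQc⟩ :=
      exists_tendsto_root_divByMonic hroots hc hm (hlow 0 m.succ_pos)
    obtain ⟨α, β, b, h1, h2, h3, h4, h5, h6⟩ := ih (c := fun k => c (k + 1)) hQroots hQc
      (fun k hk => hlow _ (Nat.succ_lt_succ hk)) hm
    refine ⟨α, β, b, h1, h2, h3, h4, h5, fun z => ?_⟩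
    have := ((ha.const_sub z).mul (h6 z)).congr' (f₂ := fun n => (P n).eval z) (by
      filter_upwards [hmul] with n hn
      rw [← hn]
      simp)
    convert this using 2
    ring

/-! ### Membership in the Pólya–Obrechkoff class -/

/-- Passage from reciprocal zeros, with zero entries allowed, to the family of zeros. -/
theorem isPolyaObrechkoff_of_reciprocal_zeros {g : ℂ → ℂ} (hg : Differentiable ℂ g) {c : ℂ} {m : ℕ}
    {α : ℝ} {β : ℂ} {b : ℕ → ℂ} (hα : 0 ≤ α) (him : ∀ j, (b j).im ≤ 0)
    (hsq : Summable fun j => ‖b j‖ ^ 2) (hsum : Summable fun j => (-b j).im)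
    (hβ : ∑' j, (-b j).im ≤ β.im)
    (h : ∀ z, g z = c * z ^ m * Complex.exp (-(α : ℂ) * z ^ 2 + β * z) *
      ∏' j, ((1 - z * b j) * Complex.exp (z * b j))) : IsPolyaObrechkoff g := by
  refine ⟨hg, c, m, α, β, {j // b j ≠ 0}, inferInstance, fun j => (b j)⁻¹, hα, ?_, ?_, ?_, ?_, ?_⟩
  · intro j
    refine ⟨?_, inv_ne_zero j.2⟩
    change 0 ≤ ((b j)⁻¹).im
    rw [Complex.inv_im]
    exact div_nonneg (neg_nonneg.2 (him j)) (Complex.normSq_nonneg _)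
  · simpa [Function.comp_def] using hsq.comp_injective
      (Subtype.val_injective (p := fun j => b j ≠ 0))
  · simpa [Function.comp_def] using hsum.comp_injective
      (Subtype.val_injective (p := fun j => b j ≠ 0))
  · simp only [inv_inv]
    have hsupp : Function.support (fun j => (-b j).im) ⊆ {j | b j ≠ 0} :=
      fun j hj hb => hj (by simp [hb])
    exact (tsum_subtype_eq_of_support_subset hsupp).trans_le hβ
  · intro z
    have hsupp : Function.mulSupport (fun j => (1 - z * b j) * Complex.exp (z * b j)) ⊆
        {j | b j ≠ 0} := fun j hj hb => hj (by simp [hb])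
    simp only [div_inv_eq_mul]
    refine ⟨?_, ?_⟩
    · exact ((hasProd_subtype_iff_of_mulSupport_subset hsupp).2
        (multipliable_one_sub_mul_exp hsq z).hasProd).multipliable
    · rw [h z]
      congr 1
      exact (tprod_subtype_eq_of_mulSupport_subset hsupp).symm

theorem theorem1p1 (P : ℕ → Polynomial ℂ) (f : PowerSeries ℂ)
    (hweak : ConvergesWeakly (fun n z => (P n).eval z) f)
    (hf : ∃ k : ℕ, PowerSeries.coeff k f ≠ 0)
    (hzeros : ∀ n, zeroSet (fun z => (P n).eval z) ⊆ closedUpperHalfPlane) :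
    ∃ g : ℂ → ℂ,
      RepresentsEntire f g ∧
      IsPolyaObrechkoff g ∧
      ConvergesStrongly (fun n z => (P n).eval z) g := by
  classical
  set c : ℕ → ℂ := fun k => PowerSeries.coeff k f with hcdef
  have hroots : ∀ n, ∀ a ∈ (P n).roots, 0 ≤ a.im := by
    intro n a ha
    obtain ⟨hne, hroot⟩ := Polynomial.mem_roots'.1 ha
    refine hzeros n ⟨?_, hroot⟩
    by_contra! hall
    exact hne (Polynomial.funext fun z => by simpa using hall z)
  have hc : ∀ k, Tendsto (fun n => (P n).coeff k) atTop (𝓝 (c k)) := by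
    intro k
    have hk : (k.factorial : ℂ) ≠ 0 := by exact_mod_cast k.factorial_ne_zero
    have := (hweak k).const_mul (k.factorial : ℂ)⁻¹
    simpa only [iteratedDeriv_eval_zero, inv_mul_cancel_left₀ hk] using this
  set m := Nat.find hf with hmdef
  have hm : c m ≠ 0 := Nat.find_spec hf
  have hlow : ∀ k < m, c k = 0 := fun k hk => not_not.1 (Nat.find_min hf hk)
  have hrootsE : ∀ᶠ n in atTop, ∀ a ∈ (P n).roots, 0 ≤ a.im := Eventually.of_forall hroots
  have hdiff := differentiable_tsum_limit_coeff hrootsE hc hm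
  refine ⟨fun z => ∑' k, c k * z ^ k, ⟨hdiff, hasSum_limit_coeff_mul_pow hrootsE hc hm⟩, ?_, ?_⟩
  · have hU : (hyperfilter ℕ : Filter ℕ) ≤ atTop := Nat.hyperfilter_le_atTop
    obtain ⟨α, β, b, h1, h2, h3, h4, h5, h6⟩ := exists_tendsto_eval_of_order_eq (U := hyperfilter ℕ)
      m (Eventually.of_forall hroots) (fun k => (hc k).mono_left hU) hlow hm
    exact isPolyaObrechkoff_of_reciprocal_zeros hdiff h1 h2 h3 h4 h5 fun z =>
      tendsto_nhds_unique ((tendsto_eval_tsum hrootsE hc hm z).mono_left hU) (h6 z)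
  · intro K hK
    obtain ⟨r, hr⟩ := hK.isBounded.subset_closedBall (0 : ℂ)
    exact (tendstoUniformlyOn_eval_tsum hrootsE hc hm r).mono hr
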